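/- **Theorem 1.2.** Let $M$ be a smooth $n$-dimensional manifold, let $g(t)$, $t\in[0,T]$ with $0<T<\infty$, be a smooth family of Riemannian metrics on $M$ solving the Ricci flow $\partial_t g=-2\,\mathrm{Rc}$, and fix $x\in M$. For a path $\gamma$ with $\gamma(0)=x$, $\gamma(t)=y$, continuous on $[0,t]$ and $C^1$ on $(0,t)$, let $\mathcal L_+(\gamma)=\int_0^t\sqrt\eta\,\bigl(R(\gamma(\eta))+|\gamma'(\eta)|^2\bigr)\,d\eta$, where the scalar curvature $R$ and the norm are those of $g(\eta)$; let $L_+(y,t)$ be the infimum of $\mathcal L_+$ over such paths for which this integral converges absolutely, and $l_+(y,t)=L_+(y,t)/(2\sqrt t)$. An $\mathcal L_+$-geodesic is a solution of the Euler-Lagrange equation $\nabla R-2\nabla_XX+4\,\mathrm{Rc}(X,\cdot)-\tfrac1\eta X=0$, $X=\gamma'$. For $V\in T_xM$ let $\gamma_V$ be the maximal $\mathcal L_+$-geodesic (within the life time $[0,T]$ of the flow) with $\gamma_V(0)=x$ and $\lim_{\eta\to0^+}\sqrt\eta\,\gamma_V'(\eta)=V$, let $\tau_V$ be the first time at which $\gamma_V$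 stops being minimizing, that is, the supremum of the $s\in(0,T)$ such that $\gamma_V$ exists on $[0,s]$ and has least $\mathcal L_+$ among the paths joining $(x,0)$ to $(\gamma_V(s),s)$ (with $\tau_V=0$ if there is no such $s$), and put $\Omega(t)=\{V\in T_xM:\tau_V>t\}$. Let $J^V_1,\dots,J^V_n$ be the $\mathcal L_+$-Jacobi fields along $\gamma_V$ (variation fields of families of $\mathcal L_+$-geodesics) with $J^V_i(0)=0$ and $(\nabla_VJ^V_i)(0)=\lim_{\eta\to0^+}\sqrt\eta\,\nabla_{\gamma_V'}J^V_i(\eta)=E_i$, where $(E_i)$ is an orthonormal basis of $(T_xM,g(0))$, and put $\mathcal L_+J_V(t)=\sqrt{\det\bigl(\langle J^V_i(t),J^V_j(t)\rangle_{g(t)}\bigr)}$, which does not depend on the basis. The weighted forward reduced volume of $g$ (based at $x$) is $$\widetilde{\mathcal V}_+(t)=\int_{\Omega(t)}t^{-\frac n2}\,e^{l_+(\gamma_V(t),t)}\,e^{-2|V|^2_{g(0)}}\,\mathcal L_+J_V(t)\,dx_{g(0)}(V)\in[0,\infty],\qquad 0<t<T,$$ where $dx_{g(0)}$ is the Euclidean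 volume on $(T_xM,g(0))$. Let $\lambda>0$, put $g^\lambda(t)=\lambda\,g(\lambda^{-1}t)$ for $t\in[0,\lambda T]$, and let $\widetilde{\mathcal V}^{\lambda}_+$ be the weighted forward reduced volume of $g^\lambda$ based at the same point $x$. Then $$\widetilde{\mathcal V}^{\lambda}_+(t)=\widetilde{\mathcal V}_+(\lambda^{-1}t)\qquad\text{for all }0<t<\lambda T .$$ -/

import Mathlib

open Set Filter Topology MeasureTheory
open scoped Manifold ContDiff

noncomputable section

namespace ForwardReduced

/-- The model space `ℝⁿ`. -/
abbrev Euc (n : ℕ) : Type := EuclideanSpace ℝ (Fin n)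

section Metric

variable {n : ℕ} {M : Type*} [TopologicalSpace M] [ChartedSpace (Euc n) M]

variable (n M) in
/-- A field of bilinear forms on the tangent spaces of `M` (for instance a Riemannian metric). -/
abbrev BilinField : Type _ :=
  ∀ p : M, TangentSpace 𝓘(ℝ, Euc n) p →L[ℝ] TangentSpace 𝓘(ℝ, Euc n) p →L[ℝ] ℝ

/-- The components of a tangent vector. In Mathlib `T_pM` is a copy of `ℝⁿ`, by means of the preferred
chart at `p`, so these are the components in that chart. -/
def comps {p : M} (u : TangentSpace 𝓘(ℝ, Euc n) p) : Euc n := u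

/-- The tangent vector at `p` with given components in the preferred chart at `p`. -/
def ofComps (p : M) (v : Euc n) : TangentSpace 𝓘(ℝ, Euc n) p := v

/-- The differential `df_p(Y)` of a function `f : M → ℝ`. -/
def differential (f : M → ℝ) (p : M) (Y : TangentSpace 𝓘(ℝ, Euc n) p) : ℝ :=
  mfderiv 𝓘(ℝ, Euc n) 𝓘(ℝ, ℝ) f p Y

/-- The `i`-th coordinate vector of `ℝⁿ`. -/
def stdVec (i : Fin n) : Euc n := EuclideanSpace.single i 1

/-- Partial derivative `∂ᵢ f` at `y`, for a function of the coordinates. -/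
def pderiv (i : Fin n) (f : Euc n → ℝ) (y : Euc n) : ℝ := fderiv ℝ f y (stdVec i)

/-- The coordinate vector field `∂ᵢ` of the preferred chart at `p`, at the point with
coordinates `y`. -/
def coordVec (p : M) (i : Fin n) (y : Euc n) :
    TangentSpace 𝓘(ℝ, Euc n) ((extChartAt 𝓘(ℝ, Euc n) p).symm y) :=
  mfderiv 𝓘(ℝ, Euc n) 𝓘(ℝ, Euc n) (extChartAt 𝓘(ℝ, Euc n) p).symm y (stdVec i)

/-- The matrix `(gᵢⱼ)` of `g` in the preferred chart at `p`, at the point with coordinates `y`. -/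
def metricMatrix (g : BilinField n M) (p : M) (y : Euc n) : Matrix (Fin n) (Fin n) ℝ :=
  Matrix.of fun i j => g ((extChartAt 𝓘(ℝ, Euc n) p).symm y) (coordVec p i y) (coordVec p j y)

/-- Christoffel symbol
`Γᵏᵢⱼ = ½ ∑ₗ gᵏˡ (∂ᵢ gⱼₗ + ∂ⱼ gᵢₗ - ∂ₗ gᵢⱼ)` in the preferred chart at `p`. -/
def christoffel (g : BilinField n M) (p : M) (k i j : Fin n) (y : Euc n) : ℝ :=
  (1 / 2) * ∑ l, (metricMatrix g p y)⁻¹ k l *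
    (pderiv i (fun z => metricMatrix g p z j l) y + pderiv j (fun z => metricMatrix g p z i l) y
      - pderiv l (fun z => metricMatrix g p z i j) y)

/-- Components of the Ricci tensor in the preferred chart at `p`:
`Rᵢⱼ = ∂ₖ Γᵏᵢⱼ - ∂ⱼ Γᵏᵢₖ + Γᵏₖₗ Γˡᵢⱼ - Γᵏⱼₗ Γˡᵢₖ`. -/
def ricciCoord (g : BilinField n M) (p : M) (i j : Fin n) (y : Euc n) : ℝ :=
  ∑ k, (pderiv k (christoffel g p k i j) y - pderiv j (christoffel g p k i k) y
    + ∑ l, (christoffel g p k k l y * christoffel g p l i j y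
      - christoffel g p k j l y * christoffel g p l i k y))

/-- The Ricci tensor `Rc(u, v)` at `p`. -/
def ricci (g : BilinField n M) (p : M) (u v : TangentSpace 𝓘(ℝ, Euc n) p) : ℝ :=
  ∑ i, ∑ j, ricciCoord g p i j (extChartAt 𝓘(ℝ, Euc n) p p) * comps u i *
    comps v j

/-- The scalar curvature `R = ∑ gⁱʲ Rᵢⱼ` at `p`. -/
def scalarCurv (g : BilinField n M) (p : M) : ℝ :=
  ∑ i, ∑ j, (metricMatrix g p (extChartAt 𝓘(ℝ, Euc n) p p))⁻¹ i j *
    ricciCoord g p i j (extChartAt 𝓘(ℝ, Euc n) p p)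

/-- The quadratic term `(Γᵏᵢⱼ uⁱ vʲ)ₖ` of the connection at `p`. -/
def christoffelForm (g : BilinField n M) (p : M) (u v : TangentSpace 𝓘(ℝ, Euc n) p) :
    TangentSpace 𝓘(ℝ, Euc n) p :=
  ofComps p <| WithLp.toLp 2 fun k => ∑ i, ∑ j,
    christoffel g p k i j (extChartAt 𝓘(ℝ, Euc n) p p) * comps u i *
      comps v j

/-- The velocity `γ'(η)`. -/
def velocity (γ : ℝ → M) (η : ℝ) : TangentSpace 𝓘(ℝ, Euc n) (γ η) :=
  mfderiv 𝓘(ℝ, ℝ) 𝓘(ℝ, Euc n) γ η (1 : ℝ)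

/-- The covariant derivative `∇_{γ'} Y` at parameter `η`, for the Levi-Civita connection of `g`, of
a vector field `Y` along `γ`; written in the preferred chart at `γ η`:
`(Yᵏ)' + Γᵏᵢⱼ (γ')ⁱ Yʲ`. -/
def covDerivAlong [IsManifold 𝓘(ℝ, Euc n) ∞ M] (g : BilinField n M) (γ : ℝ → M)
    (Y : ∀ η, TangentSpace 𝓘(ℝ, Euc n) (γ η)) (η : ℝ) : TangentSpace 𝓘(ℝ, Euc n) (γ η) :=
  ofComps (γ η)
    (deriv (fun s => (trivializationAt (Euc n) (TangentSpace 𝓘(ℝ, Euc n) : M → Type _) (γ η)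
      (⟨γ s, Y s⟩ : TangentBundle 𝓘(ℝ, Euc n) M)).2) η)
    + christoffelForm g (γ η) (velocity γ η) (Y η)

/-- The volume measure `dx_g` of the Euclidean vector space `(T_xM, g_x)`:
`√det(gᵢⱼ)` times Lebesgue measure in linear coordinates. -/
def tangentVolume (g : BilinField n M) (x : M) : Measure (Euc n) :=
  ENNReal.ofReal (Real.sqrt (Matrix.of fun i j : Fin n =>
    g x (ofComps x (stdVec i)) (ofComps x (stdVec j))).det) • volume

/-- Ricci flow `∂g/∂t = -2 Rc` on `M × [0, T]`: a smooth family of Riemannian metrics `g t`,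
`t ∈ [0, T]`. Nothing is required of `g t` for `t` outside `[0, T]`. -/
structure IsRicciFlow [IsManifold 𝓘(ℝ, Euc n) ∞ M] (g : ℝ → BilinField n M) (T : ℝ) : Prop where
  symm : ∀ t ∈ Icc 0 T, ∀ (p : M) (u v : TangentSpace 𝓘(ℝ, Euc n) p), g t p u v = g t p v u
  pos : ∀ t ∈ Icc 0 T, ∀ (p : M) (u : TangentSpace 𝓘(ℝ, Euc n) p), u ≠ 0 → 0 < g t p u u
  smooth : ContMDiffOn (𝓘(ℝ, ℝ).prod 𝓘(ℝ, Euc n))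
    (𝓘(ℝ, Euc n).prod 𝓘(ℝ, Euc n →L[ℝ] Euc n →L[ℝ] ℝ)) ∞
    (fun q : ℝ × M => Bundle.TotalSpace.mk' (Euc n →L[ℝ] Euc n →L[ℝ] ℝ)
      (E := fun p : M => TangentSpace 𝓘(ℝ, Euc n) p →L[ℝ] TangentSpace 𝓘(ℝ, Euc n) p →L[ℝ] ℝ)
      q.2 (g q.1 q.2)) (Icc 0 T ×ˢ univ)
  flow : ∀ t ∈ Icc 0 T, ∀ (p : M) (u v : TangentSpace 𝓘(ℝ, Euc n) p),
    HasDerivWithinAt (fun s => g s p u v) (-2 * ricci (g t) p u v) (Icc 0 T) t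

/-- The parabolic rescaling `t ↦ c g(c⁻¹ t)`. -/
def rescale (c : ℝ) (g : ℝ → BilinField n M) : ℝ → BilinField n M :=
  fun t p => c • g (c⁻¹ * t) p

end Metric

section LPlus

variable {n : ℕ} {M : Type*} [TopologicalSpace M] [ChartedSpace (Euc n) M]
  [IsManifold 𝓘(ℝ, Euc n) ∞ M]

/-- The integrand `√η (R(γ(η)) + |γ'(η)|²)`, with `R` and `|·|` those of `g(η)`. -/
def lIntegrand (g : ℝ → BilinField n M) (γ : ℝ → M) (η : ℝ) : ℝ :=
  Real.sqrt η * (scalarCurv (g η) (γ η) + g η (γ η) (velocity γ η) (velocity γ η))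

/-- The forward length `𝓛₊(γ) = ∫₀ᵗ √η (R + |γ'|²) dη`. -/
def lLength (g : ℝ → BilinField n M) (γ : ℝ → M) (t : ℝ) : ℝ :=
  ∫ η in (0 : ℝ)..t, lIntegrand g γ η

/-- Paths `γ` joining `(x, 0)` and `(y, t)` of finite forward length: continuous on `[0, t]`,
continuously differentiable in the interior (the velocity may blow up at time `0`). -/
structure IsPath (g : ℝ → BilinField n M) (x y : M) (t : ℝ) (γ : ℝ → M) : Prop where
  start : γ 0 = x
  finish : γ t = y
  continuousOn : ContinuousOn γ (Icc 0 t)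
  contMDiffOn : ContMDiffOn 𝓘(ℝ, ℝ) 𝓘(ℝ, Euc n) 1 γ (Ioo 0 t)
  integrable : IntervalIntegrable (lIntegrand g γ) volume 0 t

/-- `L₊(y, t)`: the least forward length of a path joining `(x, 0)` and `(y, t)`. -/
def lDist (g : ℝ → BilinField n M) (x y : M) (t : ℝ) : ℝ :=
  sInf {a | ∃ γ, IsPath g x y t γ ∧ a = lLength g γ t}

/-- The forward reduced distance `l₊(y, t) = L₊(y, t) / (2 √t)`. -/
def reducedDist (g : ℝ → BilinField n M) (x y : M) (t : ℝ) : ℝ :=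
  lDist g x y t / (2 * Real.sqrt t)

/-- `γ` solves, for times in `(0, b)`, the Euler-Lagrange equation of the forward length,
`∇R - 2 ∇_X X + 4 Rc(X, ·) - X / η = 0` with `X = γ'`, here paired with an arbitrary vector `Y`. -/
structure IsLGeodesic (g : ℝ → BilinField n M) (b : ℝ) (γ : ℝ → M) : Prop where
  smooth : ContMDiffOn 𝓘(ℝ, ℝ) 𝓘(ℝ, Euc n) ∞ γ (Ioo 0 b)
  equation : ∀ η ∈ Ioo 0 b, ∀ Y : TangentSpace 𝓘(ℝ, Euc n) (γ η),
    differential (scalarCurv (g η)) (γ η) Y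
      - 2 * g η (γ η) (covDerivAlong (g η) γ (velocity γ) η) Y
      + 4 * ricci (g η) (γ η) (velocity γ η) Y
      - g η (γ η) (velocity γ η) Y / η = 0

/-- `γ` is an `𝓛₊`-geodesic on `[0, b)` with `γ(0) = x` and `lim_{η → 0} √η γ'(η) = V` (the limit
is taken in the tangent bundle, so that it contains continuity of `γ` at `0`). -/
structure IsLGeodesicFrom (g : ℝ → BilinField n M) (x : M) (V : TangentSpace 𝓘(ℝ, Euc n) x)
    (b : ℝ) (γ : ℝ → M) : Prop where
  geodesic : IsLGeodesic g b γ
  start : γ 0 = x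
  initial : Tendsto
    (fun η => (⟨γ η, Real.sqrt η • velocity γ η⟩ : TangentBundle 𝓘(ℝ, Euc n) M))
    (𝓝[>] 0) (𝓝 ⟨x, V⟩)

/-- The set of points `γ(t)`, where `γ` is an `𝓛₊`-geodesic with initial data `(x, V)` which exists
up to and beyond time `t` (within the flow's lifetime `[0, T]`). Geodesics being determined by
their initial data, it has at most one element. -/
def lExpSet (g : ℝ → BilinField n M) (T : ℝ) (x : M) (V : TangentSpace 𝓘(ℝ, Euc n) x) (t : ℝ) :
    Set M :=
  {y | ∃ (b : ℝ) (γ : ℝ → M), t < b ∧ b ≤ T ∧ IsLGeodesicFrom g x V b γ ∧ γ t = y}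

open Classical in
/-- The `𝓛₊`-exponential map `(V, t) ↦ γ_V(t)`; as a function of `t` it is the maximal geodesic
`γ_V`. The value is `x` where `γ_V` does not exist. -/
def lExp (g : ℝ → BilinField n M) (T : ℝ) (x : M) (V : TangentSpace 𝓘(ℝ, Euc n) x) (t : ℝ) : M :=
  if h : (lExpSet g T x V t).Nonempty then h.some else x

/-- `γ_V` exists on `[0, s]` and minimizes the forward length among all paths joining
`(x, 0)` and `(γ_V(s), s)`. -/
def IsMinimizingUpTo (g : ℝ → BilinField n M) (T : ℝ) (x : M) (V : TangentSpace 𝓘(ℝ, Euc n) x)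
    (s : ℝ) : Prop :=
  (lExpSet g T x V s).Nonempty ∧ IsPath g x (lExp g T x V s) s (lExp g T x V) ∧
    ∀ β, IsPath g x (lExp g T x V s) s β → lLength g (lExp g T x V) s ≤ lLength g β s

/-- `τ_V`: the first time at which `γ_V` stops minimizing (`0` if it is never minimizing). -/
def stopTime (g : ℝ → BilinField n M) (T : ℝ) (x : M) (V : TangentSpace 𝓘(ℝ, Euc n) x) : ℝ :=
  sSup {s | 0 < s ∧ s < T ∧ IsMinimizingUpTo g T x V s}

/-- `Ω(t) = {V ∈ T_xM : τ_V > t}`. -/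
def omega (g : ℝ → BilinField n M) (T : ℝ) (x : M) (t : ℝ) : Set (Euc n) :=
  {V | t < stopTime g T x (ofComps x V)}

/-- `J` is an `𝓛₊`-Jacobi field along `γ` for times in `(0, b)`: the variation field of a smooth
one-parameter family of `𝓛₊`-geodesics through `γ`. -/
def IsLJacobi (g : ℝ → BilinField n M) (b : ℝ) (γ : ℝ → M)
    (J : ∀ η, TangentSpace 𝓘(ℝ, Euc n) (γ η)) : Prop :=
  ∃ (ε : ℝ) (Γ : ℝ → ℝ → M), 0 < ε ∧
    ContMDiffOn (𝓘(ℝ, ℝ).prod 𝓘(ℝ, ℝ)) 𝓘(ℝ, Euc n) ∞ (fun q : ℝ × ℝ => Γ q.1 q.2)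
      (Ioo (-ε) ε ×ˢ Ioo 0 b) ∧
    (∀ u ∈ Ioo (-ε) ε, IsLGeodesic g b (Γ u)) ∧
    ∀ η ∈ Ioo 0 b, Γ 0 η = γ η ∧
      (⟨γ η, J η⟩ : TangentBundle 𝓘(ℝ, Euc n) M) =
        ⟨Γ 0 η, velocity (fun u => Γ u η) 0⟩

/-- `J` is an `𝓛₊`-Jacobi field along `γ_V` on `[0, b)` with `J(0) = 0` and `(∇_V J)(0) = E`. Since
`V = lim √η γ_V'(η)`, the latter means `lim √η ∇_{γ_V'} J(η) = E`. -/
structure IsLJacobiFrom (g : ℝ → BilinField n M) (T : ℝ) (x : M)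
    (V E : TangentSpace 𝓘(ℝ, Euc n) x) (b : ℝ)
    (J : ∀ η, TangentSpace 𝓘(ℝ, Euc n) (lExp g T x V η)) : Prop where
  jacobi : IsLJacobi g b (lExp g T x V) J
  initial_zero : Tendsto
    (fun η => (⟨lExp g T x V η, J η⟩ : TangentBundle 𝓘(ℝ, Euc n) M)) (𝓝[>] 0) (𝓝 ⟨x, 0⟩)
  initial_deriv : Tendsto
    (fun η => (⟨lExp g T x V η, Real.sqrt η • covDerivAlong (g η) (lExp g T x V) J η⟩ :
      TangentBundle 𝓘(ℝ, Euc n) M)) (𝓝[>] 0) (𝓝 ⟨x, E⟩)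

/-- `𝓛₊J_V(t) = √det(⟨Jᵢ(t), Jⱼ(t)⟩_{g(t)})`, where the `Jᵢ` are `𝓛₊`-Jacobi fields along `γ_V` with
`Jᵢ(0) = 0`, `(∇_V Jᵢ)(0) = Eᵢ`, for an orthonormal basis `(Eᵢ)` of `(T_xM, g(0))`. The value is
independent of the basis, so for `t < τ_V` the set below has exactly one element. -/
def lJacobian (g : ℝ → BilinField n M) (T : ℝ) (x : M) (V : TangentSpace 𝓘(ℝ, Euc n) x)
    (t : ℝ) : ℝ :=
  sSup {a | ∃ (E : Fin n → TangentSpace 𝓘(ℝ, Euc n) x) (b : ℝ)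
    (J : Fin n → ∀ η, TangentSpace 𝓘(ℝ, Euc n) (lExp g T x V η)),
    (∀ i j, g 0 x (E i) (E j) = if i = j then 1 else 0) ∧ t < b ∧ b ≤ T ∧
    (∀ i, IsLJacobiFrom g T x V (E i) b (J i)) ∧
    a = Real.sqrt (Matrix.of fun i j => g t (lExp g T x V t) (J i t) (J j t)).det}

/-- The weighted forward reduced volume based at `x` of a flow `g` on `M × [0, T]`,
`∫_{Ω(t)} t^{-n/2} e^{l₊(γ_V(t), t)} e^{-2 |V|²_{g(0)}} 𝓛₊J_V(t) dx_{g(0)}(V)`,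
the integral of a nonnegative function, with values in `[0, ∞]`. -/
def weightedForwardReducedVolume (g : ℝ → BilinField n M) (T : ℝ) (x : M) (t : ℝ) : ENNReal :=
  ∫⁻ V in omega g T x t, ENNReal.ofReal
    (t ^ (-(n : ℝ) / 2) * Real.exp (reducedDist g x (lExp g T x (ofComps x V) t) t) *
      Real.exp (-2 * g 0 x (ofComps x V) (ofComps x V)) * lJacobian g T x (ofComps x V) t)
    ∂(tangentVolume (g 0) x)

end LPlus

end ForwardReduced

end

/-!
Parabolic scaling is a symmetry of every ingredient of the weighted forward reduced volume. The flow
`g^c(t) = c g(c⁻¹ t)` has the same connection and Ricci tensor as `g` at the corresponding time, and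
its scalar curvature is divided by `c`. Slowing a curve `γ` down to `s ↦ γ(c⁻¹ s)` therefore
multiplies the forward length by `√c` (`lLength_rescale`) and preserves the Euler-Lagrange equation
(`isLGeodesic_rescale_iff`). It gives a bijection between the paths, and between the geodesics, of
the two flows. Hence the reduced distance is invariant (`reducedDist_rescale`).

As `√η = √c √(c⁻¹ η)`, the initial vector `V = lim √η γ'(η)` is divided by `√c`. So `γ_V` for `g`
corresponds to `γ_{V/√c}` for `g^c` (`lExp_rescale`), and the stopping time is multiplied by `c`
(`stopTime_rescale`). Slowed down Jacobi fields are Jacobi fields with initial derivatives `Eᵢ/√c`,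
which form an orthonormal basis for `c g(0)` when the `Eᵢ` form one for `g(0)`, and their Gram matrix
at the final time is multiplied by `c` (`lJacobian_rescale`). The resulting factor `c^{n/2}` of the
Jacobian is absorbed by `t^{-n/2}`. Finally `V ↦ V/√c` is an isometry from `(T_xM, g(0))` to
`(T_xM, c g(0))`, so it preserves `|V|²` and carries one volume measure to the other
(`tangentVolume_smul`); the change of variables `V ↦ V/√c` in the integral is the claim.

All these identities are exact: rescaling by a nonzero constant also respects the default values of
derivatives, inverse matrices, infima and suprema. In particular the sets of endpoints of geodesics
of the two flows are equal, and so are the points chosen from them.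
-/

noncomputable section

namespace ForwardReduced

/-! ### Homothetic metrics -/

section Homothety

variable {n : ℕ} {M : Type*} [TopologicalSpace M] [ChartedSpace (Euc n) M]

/-- For a singular matrix both sides are zero. -/
lemma nonsing_inv_smul {ι : Type*} [Fintype ι] [DecidableEq ι] {c : ℝ} (hc : c ≠ 0)
    (A : Matrix ι ι ℝ) : (c • A)⁻¹ = c⁻¹ • A⁻¹ := by
  by_cases h : IsUnit A.det
  · exact Matrix.inv_smul' A (Units.mk0 c hc) h
  · have h' : ¬ IsUnit (c • A).det := by
      rw [Matrix.det_smul, isUnit_iff_ne_zero, not_not] at *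
      rw [h, mul_zero]
    rw [Matrix.nonsing_inv_apply_not_isUnit _ h, Matrix.nonsing_inv_apply_not_isUnit _ h',
      smul_zero]

/-- This holds for every `f`: where `f` is not differentiable, both sides are zero. -/
lemma pderiv_const_mul (c : ℝ) (i : Fin n) (f : Euc n → ℝ) (y : Euc n) :
    pderiv i (fun z => c * f z) y = c * pderiv i f y := by
  have := congrFun (fderiv_const_smul_field (𝕜 := ℝ) (f := f) c) y
  exact congrArg (fun L : Euc n →L[ℝ] ℝ => L (stdVec i)) this

lemma metricMatrix_smul (c : ℝ) (g : BilinField n M) (p : M) (y : Euc n) :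
    metricMatrix (c • g) p y = c • metricMatrix g p y := rfl

/-- The Levi-Civita connection does not change when the metric is multiplied by a constant. -/
lemma christoffel_smul {c : ℝ} (hc : c ≠ 0) (g : BilinField n M) (p : M) (k i j : Fin n) :
    christoffel (c • g) p k i j = christoffel g p k i j := by
  funext y
  unfold christoffel
  simp only [metricMatrix_smul, nonsing_inv_smul hc, Matrix.smul_apply, smul_eq_mul,
    pderiv_const_mul]
  congr 1
  refine Finset.sum_congr rfl fun l _ => ?_
  field_simp

lemma ricci_smul {c : ℝ} (hc : c ≠ 0) (g : BilinField n M) : ricci (c • g) = ricci g := by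
  funext p u v
  simp only [ricci, ricciCoord, christoffel_smul hc]

lemma scalarCurv_smul {c : ℝ} (hc : c ≠ 0) (g : BilinField n M) :
    scalarCurv (c • g) = fun p => c⁻¹ * scalarCurv g p := by
  funext p
  simp only [scalarCurv, ricciCoord, christoffel_smul hc, metricMatrix_smul, nonsing_inv_smul hc,
    Matrix.smul_apply, smul_eq_mul, Finset.mul_sum, mul_assoc]

/-- Division by `√c` is an isometry from `(T_xM, g)` to `(T_xM, c g)`. -/
lemma smul_metric_inv_sqrt_smul {c : ℝ} (hc : 0 < c) (g : BilinField n M) (p : M)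
    (u v : TangentSpace 𝓘(ℝ, Euc n) p) :
    (c • g) p ((√c)⁻¹ • u) ((√c)⁻¹ • v) = g p u v := by
  have hs := (Real.sqrt_pos.2 hc).ne'
  change c * g p ((√c)⁻¹ • u) ((√c)⁻¹ • v) = _
  rw [map_smul, map_smul, smul_apply, smul_eq_mul, smul_eq_mul, ← mul_assoc, ← mul_assoc]
  nth_rewrite 1 [← Real.mul_self_sqrt hc.le]
  field_simp

lemma christoffelForm_smul_metric {c : ℝ} (hc : c ≠ 0) (g : BilinField n M) :
    christoffelForm (c • g) = christoffelForm g := by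
  funext p u v
  simp only [christoffelForm, christoffel_smul hc]

lemma christoffelForm_smul (g : BilinField n M) (p : M) (a b : ℝ)
    (u v : TangentSpace 𝓘(ℝ, Euc n) p) :
    christoffelForm g p (a • u) (b • v) = (a * b) • christoffelForm g p u v := by
  refine PiLp.ext fun k => ?_
  change (∑ i, ∑ j, christoffel g p k i j (extChartAt 𝓘(ℝ, Euc n) p p) * (a * comps u i) *
      (b * comps v j)) = (a * b) * ∑ i, ∑ j,
    christoffel g p k i j (extChartAt 𝓘(ℝ, Euc n) p p) * comps u i * comps v j
  simp only [Finset.mul_sum]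
  refine Finset.sum_congr rfl fun i _ => Finset.sum_congr rfl fun j _ => ?_
  ring

lemma ricci_smul_left (g : BilinField n M) (p : M) (a : ℝ) (u v : TangentSpace 𝓘(ℝ, Euc n) p) :
    ricci g p (a • u) v = a * ricci g p u v := by
  change (∑ i, ∑ j, ricciCoord g p i j (extChartAt 𝓘(ℝ, Euc n) p p) * (a * comps u i) *
      comps v j) = a * ∑ i, ∑ j,
    ricciCoord g p i j (extChartAt 𝓘(ℝ, Euc n) p p) * comps u i * comps v j
  simp only [Finset.mul_sum]
  refine Finset.sum_congr rfl fun i _ => Finset.sum_congr rfl fun j _ => ?_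
  ring

lemma differential_const_mul {c : ℝ} (hc : c ≠ 0) (f : M → ℝ) (p : M)
    (Y : TangentSpace 𝓘(ℝ, Euc n) p) :
    differential (fun q => c * f q) p Y = c * differential f p Y := by
  unfold differential
  by_cases h : MDifferentiableAt 𝓘(ℝ, Euc n) 𝓘(ℝ, ℝ) f p
  · exact congrArg (fun L : Euc n →L[ℝ] ℝ => L Y) (const_smul_mfderiv h c)
  · have h' : ¬ MDifferentiableAt 𝓘(ℝ, Euc n) 𝓘(ℝ, ℝ) (fun q => c * f q) p := by
      intro h'
      refine h ?_
      have := h'.const_smul c⁻¹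
      convert this using 1
      funext q
      simp [hc]
    rw [mfderiv_zero_of_not_mdifferentiableAt h, mfderiv_zero_of_not_mdifferentiableAt h']
    exact (mul_zero c).symm

end Homothety

/-! ### Slowing down a curve -/

section Reparametrization

variable {n : ℕ} {M : Type*} [TopologicalSpace M] [ChartedSpace (Euc n) M]

/-- The chain rule; no differentiability is needed, since both velocities are zero when `γ` is not
differentiable at `k η`. -/
lemma velocity_comp_mul {k : ℝ} (hk : k ≠ 0) (γ : ℝ → M) (η : ℝ) :
    velocity (n := n) (fun s => γ (k * s)) η = (k • velocity (n := n) γ (k * η) :) := by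
  have hmul : ∀ (r s : ℝ), HasMFDerivAt 𝓘(ℝ, ℝ) 𝓘(ℝ, ℝ) (fun s : ℝ => r * s) s
      (r • ContinuousLinearMap.id ℝ ℝ) := fun r s =>
    ((hasFDerivAt_id s).const_smul r).hasMFDerivAt
  unfold velocity
  by_cases h : MDifferentiableAt 𝓘(ℝ, ℝ) 𝓘(ℝ, Euc n) γ (k * η)
  · have h1 := (h.hasMFDerivAt.comp η (hmul k η)).mfderiv
    have h2 : mfderiv 𝓘(ℝ, ℝ) 𝓘(ℝ, Euc n) (fun s => γ (k * s)) η = _ := h1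
    rw [h2]
    exact (mfderiv 𝓘(ℝ, ℝ) 𝓘(ℝ, Euc n) γ (k * η)).map_smul k (1 : ℝ)
  · have h' : ¬ MDifferentiableAt 𝓘(ℝ, ℝ) 𝓘(ℝ, Euc n) (fun s => γ (k * s)) η := by
      intro h'
      refine h ?_
      have e : k⁻¹ * (k * η) = η := by field_simp
      have := MDifferentiableAt.comp (k * η) (e.symm ▸ h') (hmul k⁻¹ (k * η)).mdifferentiableAt
      convert this using 1
      funext s
      simp [hk]
    rw [mfderiv_zero_of_not_mdifferentiableAt h, mfderiv_zero_of_not_mdifferentiableAt h']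
    exact (smul_zero (A := Euc n) k).symm

variable [IsManifold 𝓘(ℝ, Euc n) ∞ M]

/-- The point `q` need not lie in the base set: the formula for the trivializations of the tangent
bundle is linear in the fibre at every point. -/
lemma trivializationAt_smul (p q : M) (a : ℝ) (v : TangentSpace 𝓘(ℝ, Euc n) q) :
    (trivializationAt (Euc n) (TangentSpace 𝓘(ℝ, Euc n) : M → Type _) p
      (⟨q, a • v⟩ : TangentBundle 𝓘(ℝ, Euc n) M)).2 =
    a • (trivializationAt (Euc n) (TangentSpace 𝓘(ℝ, Euc n) : M → Type _) p
      (⟨q, v⟩ : TangentBundle 𝓘(ℝ, Euc n) M)).2 := by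
  simp only [TangentBundle.trivializationAt_apply]
  exact ContinuousLinearMap.map_smul _ a v

lemma covDerivAlong_smul_metric {c : ℝ} (hc : c ≠ 0) (g : BilinField n M) (γ : ℝ → M)
    (Y : ∀ η, TangentSpace 𝓘(ℝ, Euc n) (γ η)) :
    covDerivAlong (c • g) γ Y = covDerivAlong g γ Y := by
  funext η
  simp only [covDerivAlong, christoffelForm_smul_metric hc]

/-- No regularity of `γ` or `Y` is needed, since `deriv` commutes with scaling the argument and the
value by constants, for every function. -/
lemma covDerivAlong_comp_mul {k : ℝ} (hk : k ≠ 0) (a : ℝ) (g : BilinField n M) (γ : ℝ → M)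
    (Y : ∀ η, TangentSpace 𝓘(ℝ, Euc n) (γ η)) (η : ℝ) :
    covDerivAlong g (fun s => γ (k * s)) (fun s => a • Y (k * s)) η =
      ((k * a) • covDerivAlong g γ Y (k * η) :) := by
  unfold covDerivAlong
  rw [velocity_comp_mul hk, christoffelForm_smul, smul_add]
  congr 1
  simp only [trivializationAt_smul]
  set f : ℝ → Euc n := fun s => (trivializationAt (Euc n)
    (TangentSpace 𝓘(ℝ, Euc n) : M → Type _) (γ (k * η))
      (⟨γ s, Y s⟩ : TangentBundle 𝓘(ℝ, Euc n) M)).2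
  have h : deriv (fun s => a • f (k * s)) η = (k * a) • deriv f (k * η) := by
    have h1 := deriv_const_smul_field (𝕜 := ℝ) (x := η) a (fun s => f (k * s))
    have h2 : deriv (fun s => f (k * s)) η = k • deriv f (k * η) := deriv_comp_mul_left k f η
    rw [mul_comm, mul_smul, ← h2]
    exact h1
  exact h

lemma tendsto_tangentBundle_smul {α : Type*} {l : Filter α} {x : M} {p : α → M}
    {v : ∀ s, TangentSpace 𝓘(ℝ, Euc n) (p s)} {V : TangentSpace 𝓘(ℝ, Euc n) x} (a : ℝ)
    (h : Tendsto (fun s => (⟨p s, v s⟩ : TangentBundle 𝓘(ℝ, Euc n) M)) l (𝓝 ⟨x, V⟩)) :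
    Tendsto (fun s => (⟨p s, a • v s⟩ : TangentBundle 𝓘(ℝ, Euc n) M)) l (𝓝 ⟨x, a • V⟩) := by
  have key := fun (f : α → TangentBundle 𝓘(ℝ, Euc n) M) (z : TangentBundle 𝓘(ℝ, Euc n) M) =>
    (trivializationAt (Euc n) (TangentSpace 𝓘(ℝ, Euc n) : M → Type _) z.1).tendsto_nhds_iff
      (l := l) (f := f) (z := z) FiberBundle.mem_trivializationAt_proj_source
  rw [key] at h ⊢
  refine ⟨h.1, ?_⟩
  simp only [trivializationAt_smul]
  exact h.2.const_smul a

lemma tendsto_mul_nhdsGT_zero {k : ℝ} (hk : 0 < k) :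
    Tendsto (fun η : ℝ => k * η) (𝓝[>] 0) (𝓝[>] 0) := by
  refine tendsto_nhdsWithin_iff.2 ⟨?_, ?_⟩
  · have : Tendsto (fun η : ℝ => k * η) (𝓝 0) (𝓝 (k * 0)) := tendsto_id.const_mul k
    rw [mul_zero] at this
    exact this.mono_left nhdsWithin_le_nhds
  · filter_upwards [self_mem_nhdsWithin] with η hη using mul_pos hk hη

end Reparametrization

/-! ### The forward length and the reduced distance under parabolic rescaling -/

/-- Every curve is a slowed down curve, so that it suffices to test a property of curves on
those. -/
lemma forall_slowed_curve_iff {c : ℝ} (hc : c ≠ 0) {X : Type*} {P : (ℝ → X) → Prop} :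
    (∀ γ, P γ) ↔ ∀ γ : ℝ → X, P fun s => γ (c⁻¹ * s) := by
  refine ⟨fun h γ => h _, fun h γ => ?_⟩
  simpa only [mul_inv_cancel_left₀ hc] using h fun s => γ (c * s)

lemma exists_slowed_curve_iff {c : ℝ} (hc : c ≠ 0) {X : Type*} {P : (ℝ → X) → Prop} :
    (∃ γ, P γ) ↔ ∃ γ : ℝ → X, P fun s => γ (c⁻¹ * s) := by
  simpa only [not_forall, not_not] using
    not_congr (forall_slowed_curve_iff hc (P := fun γ => ¬ P γ))

section Rescaling

variable {n : ℕ} {M : Type*} [TopologicalSpace M] [ChartedSpace (Euc n) M]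

lemma rescale_apply (c : ℝ) (g : ℝ → BilinField n M) (t : ℝ) :
    rescale c g t = c • g (c⁻¹ * t) := rfl

lemma rescale_inv_rescale {c : ℝ} (hc : c ≠ 0) (g : ℝ → BilinField n M) :
    rescale c⁻¹ (rescale c g) = g := by
  funext t
  rw [rescale_apply, rescale_apply, smul_smul, inv_mul_cancel₀ hc, one_smul, inv_inv,
    inv_mul_cancel_left₀ hc]

variable {c : ℝ}

lemma sqrt_eq_sqrt_mul_sqrt_inv_mul (hc : 0 < c) (t : ℝ) : √t = √c * √(c⁻¹ * t) := by
  rw [← Real.sqrt_mul hc.le, mul_inv_cancel_left₀ hc.ne']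

/-- Both `R` and `|γ'|²` are divided by `c`, and `√η = √c √(c⁻¹ η)`. -/
lemma lIntegrand_rescale (hc : 0 < c) (g : ℝ → BilinField n M) (γ : ℝ → M) (η : ℝ) :
    lIntegrand (rescale c g) (fun s => γ (c⁻¹ * s)) η = (√c)⁻¹ * lIntegrand g γ (c⁻¹ * η) := by
  unfold lIntegrand
  rw [rescale_apply, scalarCurv_smul hc.ne', velocity_comp_mul (inv_ne_zero hc.ne')]
  have e : (c • g (c⁻¹ * η)) (γ (c⁻¹ * η)) (c⁻¹ • velocity γ (c⁻¹ * η))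
      (c⁻¹ • velocity γ (c⁻¹ * η)) =
      c⁻¹ * g (c⁻¹ * η) (γ (c⁻¹ * η)) (velocity γ (c⁻¹ * η)) (velocity γ (c⁻¹ * η)) := by
    change c * (g (c⁻¹ * η) (γ (c⁻¹ * η)) (c⁻¹ • velocity γ (c⁻¹ * η))
      (c⁻¹ • velocity γ (c⁻¹ * η))) = _
    rw [map_smul, map_smul, smul_apply, smul_eq_mul, smul_eq_mul]
    field_simp
  rw [e, sqrt_eq_sqrt_mul_sqrt_inv_mul hc η]
  have hs : √c * c⁻¹ = (√c)⁻¹ := by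
    rw [← div_eq_mul_inv, Real.sqrt_div_self]
  rw [← hs]
  ring

lemma lLength_rescale (hc : 0 < c) (g : ℝ → BilinField n M) (γ : ℝ → M) (t : ℝ) :
    lLength (rescale c g) (fun s => γ (c⁻¹ * s)) t = √c * lLength g γ (c⁻¹ * t) := by
  unfold lLength
  simp only [lIntegrand_rescale hc]
  rw [intervalIntegral.integral_const_mul,
    intervalIntegral.integral_comp_mul_left (fun η => lIntegrand g γ η) (inv_ne_zero hc.ne'),
    inv_inv, mul_zero, smul_eq_mul, ← mul_assoc]
  congr 1
  rw [inv_mul_eq_div, Real.div_sqrt]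

lemma mapsTo_inv_mul_Ioo (hc : 0 < c) (b : ℝ) :
    MapsTo (fun s : ℝ => c⁻¹ * s) (Ioo 0 b) (Ioo 0 (c⁻¹ * b)) := fun _ hs =>
  ⟨mul_pos (inv_pos.2 hc) hs.1, mul_lt_mul_of_pos_left hs.2 (inv_pos.2 hc)⟩

lemma contMDiff_const_mul (k : ℝ) {m : WithTop ℕ∞} :
    ContMDiff 𝓘(ℝ, ℝ) 𝓘(ℝ, ℝ) m (fun s : ℝ => k * s) :=
  (contDiff_const.mul contDiff_id).contMDiff

lemma IsPath.rescale (hc : 0 < c) {g : ℝ → BilinField n M} {x y : M} {t : ℝ} {γ : ℝ → M}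
    (h : IsPath g x y (c⁻¹ * t) γ) :
    IsPath (rescale c g) x y t (fun s => γ (c⁻¹ * s)) where
  start := by simpa using h.start
  finish := h.finish
  continuousOn := h.continuousOn.comp (continuous_const_mul c⁻¹).continuousOn fun s hs =>
    ⟨mul_nonneg (inv_pos.2 hc).le hs.1, mul_le_mul_of_nonneg_left hs.2 (inv_pos.2 hc).le⟩
  contMDiffOn := h.contMDiffOn.comp (contMDiff_const_mul c⁻¹).contMDiffOn
    (mapsTo_inv_mul_Ioo hc t)
  integrable := by
    have h1 : lIntegrand (ForwardReduced.rescale c g) (fun s => γ (c⁻¹ * s)) =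
        fun η => (√c)⁻¹ * lIntegrand g γ (c⁻¹ * η) := funext (lIntegrand_rescale hc g γ)
    rw [h1]
    have h2 := h.integrable.comp_mul_left (c := c⁻¹)
    simp only [zero_div, mul_div_cancel_left₀ t (inv_ne_zero hc.ne')] at h2
    exact h2.const_mul _

/-- The converse implication is `IsPath.rescale` for the rescaled flow and the factor `c⁻¹`. -/
lemma isPath_rescale_iff (hc : 0 < c) {g : ℝ → BilinField n M} {x y : M} {t : ℝ} {γ : ℝ → M} :
    IsPath (rescale c g) x y t (fun s => γ (c⁻¹ * s)) ↔ IsPath g x y (c⁻¹ * t) γ := by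
  refine ⟨fun h => ?_, IsPath.rescale hc⟩
  have h' : IsPath (rescale c g) x y (c⁻¹⁻¹ * (c⁻¹ * t)) (fun s => γ (c⁻¹ * s)) := by
    rwa [inv_inv, mul_inv_cancel_left₀ hc.ne']
  simpa only [rescale_inv_rescale hc.ne', inv_inv, inv_mul_cancel_left₀ hc.ne'] using
    h'.rescale (inv_pos.2 hc)

lemma lDist_rescale (hc : 0 < c) (g : ℝ → BilinField n M) (x y : M) (t : ℝ) :
    lDist (rescale c g) x y t = √c * lDist g x y (c⁻¹ * t) := by
  unfold lDist
  rw [← smul_eq_mul, ← Real.sInf_smul_of_nonneg (Real.sqrt_nonneg c)]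
  congr 1
  ext a
  rw [mem_ofPred_eq, exists_slowed_curve_iff hc.ne']
  simp only [isPath_rescale_iff hc, lLength_rescale hc, mem_smul_set, mem_ofPred_eq, smul_eq_mul]
  constructor
  · rintro ⟨γ, h, rfl⟩
    exact ⟨_, ⟨γ, h, rfl⟩, rfl⟩
  · rintro ⟨_, ⟨γ, h, rfl⟩, rfl⟩
    exact ⟨γ, h, rfl⟩

lemma reducedDist_rescale (hc : 0 < c) (g : ℝ → BilinField n M) (x y : M) (t : ℝ) :
    reducedDist (rescale c g) x y t = reducedDist g x y (c⁻¹ * t) := by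
  unfold reducedDist
  rw [lDist_rescale hc, sqrt_eq_sqrt_mul_sqrt_inv_mul hc t, mul_left_comm,
    mul_div_mul_left _ _ (Real.sqrt_pos.2 hc).ne']

/-! ### Geodesics and the exponential map under parabolic rescaling -/

variable [IsManifold 𝓘(ℝ, Euc n) ∞ M]

lemma IsLGeodesic.rescale (hc : 0 < c) {g : ℝ → BilinField n M} {b : ℝ} {γ : ℝ → M}
    (h : IsLGeodesic g (c⁻¹ * b) γ) :
    IsLGeodesic (rescale c g) b (fun s => γ (c⁻¹ * s)) where
  smooth := h.smooth.comp (contMDiff_const_mul c⁻¹).contMDiffOn (mapsTo_inv_mul_Ioo hc b)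
  equation := fun η hη Y => by
    have hc' := inv_ne_zero hc.ne'
    have key := h.equation (c⁻¹ * η) (mapsTo_inv_mul_Ioo hc b hη) Y
    have hv : velocity (n := n) (fun s => γ (c⁻¹ * s)) =
        fun s => c⁻¹ • velocity (n := n) γ (c⁻¹ * s) := funext (velocity_comp_mul hc' γ)
    have h1 : differential (scalarCurv (ForwardReduced.rescale c g η)) (γ (c⁻¹ * η)) Y =
        c⁻¹ * differential (scalarCurv (g (c⁻¹ * η))) (γ (c⁻¹ * η)) Y := by
      rw [rescale_apply, scalarCurv_smul hc.ne', differential_const_mul hc']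
    have h2 : covDerivAlong (ForwardReduced.rescale c g η) (fun s => γ (c⁻¹ * s))
        (velocity fun s => γ (c⁻¹ * s)) η =
        ((c⁻¹ * c⁻¹) • covDerivAlong (g (c⁻¹ * η)) γ (velocity γ) (c⁻¹ * η) :) := by
      rw [rescale_apply, covDerivAlong_smul_metric hc.ne', hv]
      exact covDerivAlong_comp_mul hc' c⁻¹ _ γ (velocity γ) η
    have h3 : ricci (ForwardReduced.rescale c g η) (γ (c⁻¹ * η))
        (velocity (fun s => γ (c⁻¹ * s)) η) Y =
        c⁻¹ * ricci (g (c⁻¹ * η)) (γ (c⁻¹ * η)) (velocity γ (c⁻¹ * η)) Y := by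
      rw [rescale_apply, ricci_smul hc.ne', hv]
      exact ricci_smul_left _ _ _ _ _
    have h4 : ∀ (a : ℝ) (u : TangentSpace 𝓘(ℝ, Euc n) (γ (c⁻¹ * η))),
        ForwardReduced.rescale c g η (γ (c⁻¹ * η)) (a • u) Y =
          c * (a * g (c⁻¹ * η) (γ (c⁻¹ * η)) u Y) := fun a u => by
      change c * (g (c⁻¹ * η) (γ (c⁻¹ * η)) (a • u) Y) = _
      rw [map_smul, smul_apply, smul_eq_mul]
    have hη' : η ≠ 0 := hη.1.ne'
    have hc0 := hc.ne'
    -- The rescaled equation is the original one divided by `c`.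
    have e := congrArg (fun r => c⁻¹ * r) key
    simp only [mul_zero] at e
    rw [h1, h2, h3, congrFun hv η, h4, h4, ← e]
    field_simp

/-- The converse implication is `IsLGeodesic.rescale` for the rescaled flow and the factor
`c⁻¹`. -/
lemma isLGeodesic_rescale_iff (hc : 0 < c) {g : ℝ → BilinField n M} {b : ℝ} {γ : ℝ → M} :
    IsLGeodesic (rescale c g) b (fun s => γ (c⁻¹ * s)) ↔ IsLGeodesic g (c⁻¹ * b) γ := by
  refine ⟨fun h => ?_, IsLGeodesic.rescale hc⟩
  have h' : IsLGeodesic (rescale c g) (c⁻¹⁻¹ * (c⁻¹ * b)) (fun s => γ (c⁻¹ * s)) := by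
    rwa [inv_inv, mul_inv_cancel_left₀ hc.ne']
  simpa only [rescale_inv_rescale hc.ne', inv_inv, inv_mul_cancel_left₀ hc.ne'] using
    h'.rescale (inv_pos.2 hc)

lemma sqrt_mul_inv_eq (hc : 0 < c) (η : ℝ) : √η * c⁻¹ = (√c)⁻¹ * √(c⁻¹ * η) := by
  rw [sqrt_eq_sqrt_mul_sqrt_inv_mul hc η, ← Real.sqrt_div_self, div_eq_mul_inv]
  ring

/-- Since `√η = √c √(c⁻¹ η)`, slowing a curve down by the factor `c` divides its initial vector
`lim √η γ'(η)` by `√c`. -/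
lemma IsLGeodesicFrom.rescale (hc : 0 < c) {g : ℝ → BilinField n M} {x : M}
    {V : TangentSpace 𝓘(ℝ, Euc n) x} {b : ℝ} {γ : ℝ → M}
    (h : IsLGeodesicFrom g x V (c⁻¹ * b) γ) :
    IsLGeodesicFrom (rescale c g) x ((√c)⁻¹ • V) b (fun s => γ (c⁻¹ * s)) where
  geodesic := h.geodesic.rescale hc
  start := by simpa using h.start
  initial := by
    have h1 := tendsto_tangentBundle_smul (√c)⁻¹
      (h.initial.comp (tendsto_mul_nhdsGT_zero (inv_pos.2 hc)))
    refine h1.congr fun η => ?_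
    rw [velocity_comp_mul (inv_ne_zero hc.ne'), smul_smul, smul_smul, sqrt_mul_inv_eq hc]

lemma inv_sqrt_inv_smul_inv_sqrt_smul (hc : 0 < c) {E : Type*} [AddCommGroup E] [Module ℝ E]
    (v : E) : (√c⁻¹)⁻¹ • (√c)⁻¹ • v = v := by
  rw [Real.sqrt_inv, inv_inv, smul_inv_smul₀ (Real.sqrt_pos.2 hc).ne']

lemma isLGeodesicFrom_rescale_iff (hc : 0 < c) {g : ℝ → BilinField n M} {x : M}
    {V : TangentSpace 𝓘(ℝ, Euc n) x} {b : ℝ} {γ : ℝ → M} :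
    IsLGeodesicFrom (rescale c g) x ((√c)⁻¹ • V) b (fun s => γ (c⁻¹ * s)) ↔
      IsLGeodesicFrom g x V (c⁻¹ * b) γ := by
  refine ⟨fun h => ?_, IsLGeodesicFrom.rescale hc⟩
  have h' : IsLGeodesicFrom (rescale c g) x ((√c)⁻¹ • V) (c⁻¹⁻¹ * (c⁻¹ * b))
      (fun s => γ (c⁻¹ * s)) := by
    rwa [inv_inv, mul_inv_cancel_left₀ hc.ne']
  simpa only [rescale_inv_rescale hc.ne', inv_sqrt_inv_smul_inv_sqrt_smul hc, inv_inv,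
    inv_mul_cancel_left₀ hc.ne'] using h'.rescale (inv_pos.2 hc)

lemma lExpSet_rescale (hc : 0 < c) (g : ℝ → BilinField n M) (T : ℝ) (x : M)
    (V : TangentSpace 𝓘(ℝ, Euc n) x) (t : ℝ) :
    lExpSet (rescale c g) (c * T) x ((√c)⁻¹ • V) t = lExpSet g T x V (c⁻¹ * t) := by
  ext y
  constructor
  · rintro ⟨b, γ, htb, hbT, h, hy⟩
    have hγ : (fun s => (fun r => γ (c * r)) (c⁻¹ * s)) = γ := by
      funext s
      exact congrArg γ (mul_inv_cancel_left₀ hc.ne' s)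
    rw [← hγ] at h hy
    exact ⟨c⁻¹ * b, fun r => γ (c * r), mul_lt_mul_of_pos_left htb (inv_pos.2 hc),
      (inv_mul_le_iff₀ hc).2 hbT, (isLGeodesicFrom_rescale_iff hc).1 h, hy⟩
  · rintro ⟨b, γ, htb, hbT, h, hy⟩
    refine ⟨c * b, fun s => γ (c⁻¹ * s), (inv_mul_lt_iff₀ hc).1 htb,
      mul_le_mul_of_nonneg_left hbT hc.le, (isLGeodesicFrom_rescale_iff hc).2 ?_, hy⟩
    rwa [inv_mul_cancel_left₀ hc.ne']

/-- The two sets of endpoints are equal as sets, so the points chosen from them agree whether or not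
geodesics are determined by their initial data. -/
lemma lExp_rescale (hc : 0 < c) (g : ℝ → BilinField n M) (T : ℝ) (x : M)
    (V : TangentSpace 𝓘(ℝ, Euc n) x) :
    lExp (rescale c g) (c * T) x ((√c)⁻¹ • V) = fun t => lExp g T x V (c⁻¹ * t) := by
  have key : ∀ {S S' : Set M}, S = S' → (open Classical in
      (if h : S.Nonempty then h.some else x) = if h : S'.Nonempty then h.some else x) := by
    rintro S _ rfl
    rfl
  exact funext fun t => key (lExpSet_rescale hc g T x V t)

lemma isMinimizingUpTo_rescale_iff (hc : 0 < c) (g : ℝ → BilinField n M) (T : ℝ) (x : M)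
    (V : TangentSpace 𝓘(ℝ, Euc n) x) (s : ℝ) :
    IsMinimizingUpTo (rescale c g) (c * T) x ((√c)⁻¹ • V) s ↔
      IsMinimizingUpTo g T x V (c⁻¹ * s) := by
  unfold IsMinimizingUpTo
  rw [lExpSet_rescale hc, lExp_rescale hc, isPath_rescale_iff hc,
    forall_slowed_curve_iff hc.ne']
  simp only [isPath_rescale_iff hc, lLength_rescale hc,
    mul_le_mul_iff_right₀ (Real.sqrt_pos.2 hc)]

lemma stopTime_rescale (hc : 0 < c) (g : ℝ → BilinField n M) (T : ℝ) (x : M)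
    (V : TangentSpace 𝓘(ℝ, Euc n) x) :
    stopTime (rescale c g) (c * T) x ((√c)⁻¹ • V) = c * stopTime g T x V := by
  unfold stopTime
  rw [← smul_eq_mul c (sSup _), ← Real.sSup_smul_of_nonneg hc.le]
  congr 1
  ext s
  rw [mem_smul_set_iff_inv_smul_mem₀ hc.ne', mem_ofPred_eq, mem_ofPred_eq, smul_eq_mul,
    isMinimizingUpTo_rescale_iff hc, inv_mul_lt_iff₀ hc, mul_pos_iff_of_pos_left (inv_pos.2 hc)]

lemma smul_mem_omega_rescale_iff (hc : 0 < c) (g : ℝ → BilinField n M) (T : ℝ) (x : M) (t : ℝ)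
    (V : Euc n) :
    (√c)⁻¹ • V ∈ omega (rescale c g) (c * T) x t ↔ V ∈ omega g T x (c⁻¹ * t) := by
  have h : stopTime (rescale c g) (c * T) x (ofComps x ((√c)⁻¹ • V)) =
    c * stopTime g T x (ofComps x V) := stopTime_rescale hc g T x (ofComps x V)
  simp only [omega, mem_ofPred_eq, h, inv_mul_lt_iff₀ hc]

end Rescaling

/-! ### Jacobi fields under parabolic rescaling -/

section Jacobi

open scoped Pointwise

variable {n : ℕ} {M : Type*} [TopologicalSpace M] [ChartedSpace (Euc n) M]
  [IsManifold 𝓘(ℝ, Euc n) ∞ M] {c : ℝ}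

lemma IsLJacobi.rescale (hc : 0 < c) {g : ℝ → BilinField n M} {b : ℝ} {γ : ℝ → M}
    {J : ∀ η, TangentSpace 𝓘(ℝ, Euc n) (γ η)} (h : IsLJacobi g (c⁻¹ * b) γ J) :
    IsLJacobi (rescale c g) b (fun s => γ (c⁻¹ * s)) (fun s => J (c⁻¹ * s)) := by
  obtain ⟨ε, Γ, hε, hΓ, hgeo, hJ⟩ := h
  refine ⟨ε, fun u s => Γ u (c⁻¹ * s), hε, ?_, fun u hu => (hgeo u hu).rescale hc,
    fun η hη => hJ (c⁻¹ * η) (mapsTo_inv_mul_Ioo hc b hη)⟩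
  have hφ : ContMDiff (𝓘(ℝ, ℝ).prod 𝓘(ℝ, ℝ)) (𝓘(ℝ, ℝ).prod 𝓘(ℝ, ℝ)) ∞
      (fun q : ℝ × ℝ => (q.1, c⁻¹ * q.2)) :=
    contMDiff_fst.prodMk ((contMDiff_const_mul c⁻¹).comp contMDiff_snd)
  exact hΓ.comp hφ.contMDiffOn fun q hq => ⟨hq.1, mapsTo_inv_mul_Ioo hc b hq.2⟩

/-- `J` is an `𝓛₊`-Jacobi field on `[0, b)` along an arbitrary curve `γ`, with `J(0) = 0` and
`lim √η ∇_{γ'} J(η) = E`. This is `IsLJacobiFrom` with the curve as a parameter, so that the curve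
can be rewritten although the type of `J` depends on it. -/
structure IsLJacobiAlong (g : ℝ → BilinField n M) (γ : ℝ → M) (x : M)
    (E : TangentSpace 𝓘(ℝ, Euc n) x) (b : ℝ) (J : ∀ η, TangentSpace 𝓘(ℝ, Euc n) (γ η)) :
    Prop where
  jacobi : IsLJacobi g b γ J
  initial_zero : Tendsto
    (fun η => (⟨γ η, J η⟩ : TangentBundle 𝓘(ℝ, Euc n) M)) (𝓝[>] 0) (𝓝 ⟨x, 0⟩)
  initial_deriv : Tendsto
    (fun η => (⟨γ η, Real.sqrt η • covDerivAlong (g η) γ J η⟩ :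
      TangentBundle 𝓘(ℝ, Euc n) M)) (𝓝[>] 0) (𝓝 ⟨x, E⟩)

lemma isLJacobiFrom_iff {g : ℝ → BilinField n M} {T : ℝ} {x : M}
    {V E : TangentSpace 𝓘(ℝ, Euc n) x} {b : ℝ}
    {J : ∀ η, TangentSpace 𝓘(ℝ, Euc n) (lExp g T x V η)} :
    IsLJacobiFrom g T x V E b J ↔ IsLJacobiAlong g (lExp g T x V) x E b J :=
  ⟨fun h => ⟨h.1, h.2, h.3⟩, fun h => ⟨h.1, h.2, h.3⟩⟩

lemma IsLJacobiAlong.rescale (hc : 0 < c) {g : ℝ → BilinField n M} {γ : ℝ → M} {x : M}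
    {E : TangentSpace 𝓘(ℝ, Euc n) x} {b : ℝ} {J : ∀ η, TangentSpace 𝓘(ℝ, Euc n) (γ η)}
    (h : IsLJacobiAlong g γ x E (c⁻¹ * b) J) :
    IsLJacobiAlong (rescale c g) (fun s => γ (c⁻¹ * s)) x ((√c)⁻¹ • E) b
      (fun s => J (c⁻¹ * s)) where
  jacobi := h.jacobi.rescale hc
  initial_zero := h.initial_zero.comp (tendsto_mul_nhdsGT_zero (inv_pos.2 hc))
  initial_deriv := by
    have h1 := tendsto_tangentBundle_smul (√c)⁻¹
      (h.initial_deriv.comp (tendsto_mul_nhdsGT_zero (inv_pos.2 hc)))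
    refine h1.congr fun η => ?_
    have h2 := covDerivAlong_comp_mul (inv_ne_zero hc.ne') 1 (g (c⁻¹ * η)) γ J η
    simp only [one_smul, mul_one] at h2
    rw [rescale_apply, covDerivAlong_smul_metric hc.ne', h2, smul_smul, smul_smul,
      sqrt_mul_inv_eq hc]

/-- The set of values `√det(⟨Jᵢ(t), Jⱼ(t)⟩_{g(t)})`, for the `𝓛₊`-Jacobi fields `Jᵢ` along `γ` with
`Jᵢ(0) = 0` whose initial derivatives form an orthonormal basis of `(T_xM, g(0))`; it has
`lJacobian` as its supremum when `γ` is the geodesic `γ_V`. -/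
def jacobianValues (g : ℝ → BilinField n M) (γ : ℝ → M) (T : ℝ) (x : M) (t : ℝ) : Set ℝ :=
  {a | ∃ (E : Fin n → TangentSpace 𝓘(ℝ, Euc n) x) (b : ℝ)
    (J : Fin n → ∀ η, TangentSpace 𝓘(ℝ, Euc n) (γ η)),
    (∀ i j, g 0 x (E i) (E j) = if i = j then 1 else 0) ∧ t < b ∧ b ≤ T ∧
    (∀ i, IsLJacobiAlong g γ x (E i) b (J i)) ∧
    a = √(Matrix.of fun i j => g t (γ t) (J i t) (J j t)).det}

lemma lJacobian_eq_sSup (g : ℝ → BilinField n M) (T : ℝ) (x : M)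
    (V : TangentSpace 𝓘(ℝ, Euc n) x) (t : ℝ) :
    lJacobian g T x V t = sSup (jacobianValues g (lExp g T x V) T x t) := by
  simp only [lJacobian, jacobianValues, isLJacobiFrom_iff]

lemma sqrt_det_smul (hc : 0 < c) (A : Matrix (Fin n) (Fin n) ℝ) :
    √(c • A).det = √c ^ n * √A.det := by
  rw [Matrix.det_smul, Fintype.card_fin, Real.sqrt_mul (pow_nonneg hc.le n)]
  congr 1
  rw [Real.sqrt_eq_iff_mul_self_eq (pow_nonneg hc.le n) (pow_nonneg (Real.sqrt_nonneg c) n),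
    ← mul_pow, Real.mul_self_sqrt hc.le]

/-- If `(Eᵢ)` is orthonormal for `g(0)`, then `(Eᵢ / √c)` is orthonormal for `c g(0)`, and the
Jacobi fields with these initial derivatives are the slowed down `Jᵢ`. -/
lemma smul_jacobianValues_subset (hc : 0 < c) (g : ℝ → BilinField n M) (γ : ℝ → M) (T : ℝ) (x : M)
    (t : ℝ) :
    (√c ^ n) • jacobianValues g γ T x (c⁻¹ * t) ⊆
      jacobianValues (rescale c g) (fun s => γ (c⁻¹ * s)) (c * T) x t := by
  rintro _ ⟨_, ⟨E, b, J, hE, htb, hbT, hJ, rfl⟩, rfl⟩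
  refine ⟨fun i => (√c)⁻¹ • E i, c * b, fun i s => J i (c⁻¹ * s), fun i j => ?_,
    (inv_mul_lt_iff₀ hc).1 htb, mul_le_mul_of_nonneg_left hbT hc.le, fun i => ?_, ?_⟩
  · rw [← hE i j, rescale_apply, mul_zero]
    exact smul_metric_inv_sqrt_smul hc (g 0) x (E i) (E j)
  · have h := hJ i
    rw [← inv_mul_cancel_left₀ hc.ne' b] at h
    exact h.rescale hc
  · exact (sqrt_det_smul hc _).symm

lemma jacobianValues_rescale (hc : 0 < c) (g : ℝ → BilinField n M) (γ : ℝ → M) (T : ℝ) (x : M)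
    (t : ℝ) :
    jacobianValues (rescale c g) (fun s => γ (c⁻¹ * s)) (c * T) x t =
      (√c ^ n) • jacobianValues g γ T x (c⁻¹ * t) := by
  refine Subset.antisymm ?_ (smul_jacobianValues_subset hc g γ T x t)
  -- The flow `g` is the rescaling by `c⁻¹` of its rescaling by `c`.
  have h := smul_jacobianValues_subset (inv_pos.2 hc) (rescale c g) (fun s => γ (c⁻¹ * s)) (c * T)
    x (c⁻¹ * t)
  simp only [rescale_inv_rescale hc.ne', inv_inv, inv_mul_cancel_left₀ hc.ne',
    mul_inv_cancel_left₀ hc.ne', Real.sqrt_inv, inv_pow] at h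
  intro a ha
  rw [mem_smul_set_iff_inv_smul_mem₀ (pow_pos (Real.sqrt_pos.2 hc) n).ne']
  exact h (smul_mem_smul_set ha)

lemma lJacobian_rescale (hc : 0 < c) (g : ℝ → BilinField n M) (T : ℝ) (x : M)
    (V : TangentSpace 𝓘(ℝ, Euc n) x) (t : ℝ) :
    lJacobian (rescale c g) (c * T) x ((√c)⁻¹ • V) t =
      √c ^ n * lJacobian g T x V (c⁻¹ * t) := by
  rw [lJacobian_eq_sSup, lJacobian_eq_sSup, lExp_rescale hc, jacobianValues_rescale hc,
    Real.sSup_smul_of_nonneg (pow_nonneg (Real.sqrt_nonneg c) n), smul_eq_mul]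

end Jacobi

/-! ### Change of variables in the tangent space -/

section Volume

variable {n : ℕ} {M : Type*} [TopologicalSpace M] [ChartedSpace (Euc n) M] {c : ℝ}

lemma tangentVolume_smul (hc : 0 < c) (g : BilinField n M) (x : M) :
    tangentVolume (c • g) x = (tangentVolume g x).map fun V => (√c)⁻¹ • V := by
  have hs := Real.sqrt_pos.2 hc
  unfold tangentVolume
  rw [Measure.map_smul, Measure.map_addHaar_smul volume (inv_ne_zero hs.ne'), smul_smul,
    finrank_euclideanSpace_fin, inv_pow, inv_inv, abs_of_pos (pow_pos hs n),
    ← ENNReal.ofReal_mul (Real.sqrt_nonneg _), mul_comm, ← sqrt_det_smul hc]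
  rfl

lemma rpow_neg_half_mul_pow_sqrt (hc : 0 < c) {t : ℝ} (ht : 0 < t) :
    t ^ (-(n : ℝ) / 2) * √c ^ n = (c⁻¹ * t) ^ (-(n : ℝ) / 2) := by
  rw [Real.mul_rpow (inv_pos.2 hc).le ht.le, mul_comm, Real.inv_rpow hc.le, ← Real.rpow_neg hc.le,
    Real.sqrt_eq_rpow, ← Real.rpow_natCast, ← Real.rpow_mul hc.le]
  congr 2
  ring

end Volume

end ForwardReduced

end

theorem theorem1p2 {n : ℕ} {M : Type*} [TopologicalSpace M]
    [ChartedSpace (ForwardReduced.Euc n) M] [IsManifold 𝓘(ℝ, ForwardReduced.Euc n) ∞ M]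
    [T2Space M] [SecondCountableTopology M]
    (T : ℝ) (hT : 0 < T) (g : ℝ → ForwardReduced.BilinField n M)
    (hg : ForwardReduced.IsRicciFlow g T) (x : M) (c : ℝ) (hc : 0 < c)
    (t : ℝ) (ht : 0 < t) (htT : t < c * T) :
    ForwardReduced.weightedForwardReducedVolume (ForwardReduced.rescale c g) (c * T) x t =
      ForwardReduced.weightedForwardReducedVolume g T x (c⁻¹ * t) := by
  open ForwardReduced in
  have hs : (√c)⁻¹ ≠ 0 := inv_ne_zero (Real.sqrt_pos.2 hc).ne'
  have hemb : MeasurableEmbedding fun V : Euc n => (√c)⁻¹ • V :=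
    (Homeomorph.smulOfNeZero _ hs).measurableEmbedding
  unfold weightedForwardReducedVolume
  rw [show tangentVolume (rescale c g 0) x = tangentVolume (c • g 0) x by
    rw [rescale_apply, mul_zero], tangentVolume_smul hc, hemb.restrict_map, hemb.lintegral_map]
  have hpre : (fun V : Euc n => (√c)⁻¹ • V) ⁻¹' omega (rescale c g) (c * T) x t =
      omega g T x (c⁻¹ * t) := Set.ext fun V => smul_mem_omega_rescale_iff hc g T x t V
  rw [hpre]
  refine lintegral_congr fun V => congrArg ENNReal.ofReal ?_
  have hof : ofComps x ((√c)⁻¹ • V) = (√c)⁻¹ • ofComps x V := rfl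
  have hnorm : rescale c g 0 x ((√c)⁻¹ • ofComps x V) ((√c)⁻¹ • ofComps x V) =
      g 0 x (ofComps x V) (ofComps x V) := by
    rw [rescale_apply, mul_zero]
    exact smul_metric_inv_sqrt_smul hc (g 0) x _ _
  rw [hof, hnorm, lExp_rescale hc, reducedDist_rescale hc, lJacobian_rescale hc,
    ← rpow_neg_half_mul_pow_sqrt hc ht]
  ring
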